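/- Let $\Gamma$ be a discrete group and let $A$ be a separable unital $\Gamma$-$C^*$-algebra, i.e. a separable unital $C^*$-algebra with $1\neq 0$ on which $\Gamma$ acts by $*$-automorphisms. Let $S(A)$ denote its state space with the weak$^*$ topology and the corresponding Borel $\sigma$-algebra. Let $(Y,\eta)$ be a probability space on which $\Gamma$ acts measurably (each $s\in\Gamma$ acts by a measurable map; $\eta$ need not be invariant or quasi-invariant), and let $\mu\in\mathrm{Prob}(\Gamma)$, i.e. $\mu:\Gamma\to[0,1]$ with $\sum_{s\in\Gamma}\mu(s)=1$. Then there exists a measurable map $\varphi:Y\to S(A)$ that is $\mu$-stationary: for $\eta$-almost every $y\in Y$ and every $a\in A$, \[ \sum_{s\in\Gamma}\mu(s)\,\varphi(s^{-1}y)(s^{-1}a)=\varphi(y)(a), \] the series being (absolutely) convergent. -/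

import Mathlib

open scoped ComplexOrder

/-- The state space `S(A)` of a unital C⋆-algebra `A`: the positive linear functionals `f` on `A`
with `f 1 = 1`, as a subset of the dual of `A` with its weak-⋆ topology. -/
def stateSpace (A : Type*) [CStarAlgebra A] : Set (WeakDual ℂ A) :=
  {f | (∀ a : A, 0 ≤ f (star a * a)) ∧ f 1 = 1}

/-- `S(A)` carries the Borel σ-algebra of the weak-⋆ topology. -/
noncomputable instance stateSpace.instMeasurableSpace (A : Type*) [CStarAlgebra A] :
    MeasurableSpace (stateSpace A) :=
  borel (stateSpace A)

instance stateSpace.instBorelSpace (A : Type*) [CStarAlgebra A] : BorelSpace (stateSpace A) :=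
  ⟨rfl⟩

/-- A map `φ : Y → S(A)` is `μ`-stationary (with respect to `η`) if for `η`-almost every `y`, for
all `a`, the series `∑ s, μ(s) φ(s⁻¹ y)(s⁻¹ a)` converges to `φ(y)(a)`. Here `Γ` acts on `A` by
⋆-automorphisms through `α`, so `s⁻¹ a` is `α s⁻¹ a`. -/
def IsStationaryStateMap {Γ A Y : Type*} [Group Γ] [CStarAlgebra A] [MulAction Γ Y]
    [MeasurableSpace Y] (α : Γ →* (A ≃⋆ₐ[ℂ] A)) (μ : PMF Γ) (η : MeasureTheory.Measure Y)
    (φ : Y → stateSpace A) : Prop :=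
  ∀ᵐ y ∂η, ∀ a : A,
    HasSum (fun s : Γ => ((μ s).toReal : ℂ) * (φ (s⁻¹ • y) : WeakDual ℂ A) (α s⁻¹ a))
      ((φ y : WeakDual ℂ A) a)

/-!
Averaging with weights `μ` is a contraction of `ℓ^∞(Y, A*)` which preserves the convex set of
measurable maps into `S(A)`, and the Birkhoff averages of such a map under it are stationary up to
an arbitrarily small uniform error. There is no compactness in `ℓ^∞(Y, A*)` for passing to the
limit, but the sets of `1 / (n + 1)`-stationary maps are convex and decrease with `n`. Evaluation on
a sequence that spans a dense subspace of `A` places them in the ball of a Hilbert space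
`L²(σ × ℕ)`, where the closures of decreasing bounded convex sets have a common point. So there are
`1 / (n + 1)`-stationary maps that converge `σ`-almost everywhere. If `σ` dominates `η` and its
countably many images under the maps in the support of `μ`, then by dominated convergence the limit
is stationary `η`-almost everywhere.
-/

open MeasureTheory Filter Topology
open scoped ENNReal

section Convexity

variable {ι V : Type*}

theorem hasSum_toReal_pmf (μ : PMF ι) : HasSum (fun i => (μ i).toReal) 1 := by
  have h := ENNReal.hasSum_toReal μ.tsum_coe_ne_top
  rwa [← ENNReal.tsum_toReal_eq μ.apply_ne_top, μ.tsum_coe, ENNReal.toReal_one] at h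

theorem hasSum_smul_mem_of_isClosed_of_convex [AddCommGroup V] [Module ℝ V]
    [TopologicalSpace V] [ContinuousSMul ℝ V] {K : Set V} (hclosed : IsClosed K)
    (hconv : Convex ℝ K) {w : ι → ℝ} (hw : ∀ i, 0 ≤ w i) (hw1 : HasSum w 1) {x : ι → V}
    (hx : ∀ i, x i ∈ K) {v : V} (hv : HasSum (fun i => w i • x i) v) : v ∈ K := by
  have hlim : Tendsto (fun s : Finset ι => s.centerMass w x) atTop (𝓝 v) := by
    simpa [Finset.centerMass] using (hw1.inv₀ one_ne_zero).smul hv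
  refine hclosed.mem_of_tendsto hlim ?_
  filter_upwards [hw1.eventually_const_lt zero_lt_one] with s hs
  exact hconv.centerMass_mem (fun i _ => hw i) hs fun i _ => hx i

theorem exists_mem_norm_map_sub_lt [NormedAddCommGroup V] [NormedSpace ℝ V]
    {K : Set V} (hne : K.Nonempty) (hconv : Convex ℝ K) (hbdd : Bornology.IsBounded K)
    (T : V →ₗ[ℝ] V) (hT : Set.MapsTo T K K) {ε : ℝ} (hε : 0 < ε) :
    ∃ x ∈ K, ‖T x - x‖ < ε := by
  obtain ⟨x, hx⟩ := hne
  have horbit (n : ℕ) : T^[n] x ∈ K := hT.iterate n hx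
  have hlim := tendsto_birkhoffAverage_apply_sub_birkhoffAverage ℝ (f := T) (g := id) (x := x)
    (hbdd.subset (Set.range_subset_iff.mpr horbit))
  obtain ⟨n, hn, hn0⟩ := ((hlim.norm.eventually_lt_const (by simpa using hε)).and
    (eventually_gt_atTop 0)).exists
  refine ⟨birkhoffAverage ℝ T id n x, ?_, ?_⟩
  · rw [birkhoffAverage, birkhoffSum, Finset.smul_sum]
    exact hconv.sum_mem (fun _ _ => by positivity) (by simp [hn0.ne']) fun k _ => horbit k
  · have hmap : T (birkhoffAverage ℝ T id n x) = birkhoffAverage ℝ T id n (T x) := by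
      rw [map_birkhoffAverage ℝ ℝ T]
      simp only [birkhoffAverage, birkhoffSum, Function.comp_apply, id_eq,
        ← Function.iterate_succ_apply', Function.iterate_succ_apply]
    rwa [hmap]

theorem summable_toReal_smul [NormedAddCommGroup V] [NormedSpace ℝ V] [CompleteSpace V]
    (μ : PMF ι) {x : ι → V} {R : ℝ} (hR : ∀ i, ‖x i‖ ≤ R) :
    Summable fun i => (μ i).toReal • x i := by
  refine .of_norm_bounded ((hasSum_toReal_pmf μ).summable.mul_right R) fun i => ?_
  rw [norm_smul, Real.norm_of_nonneg ENNReal.toReal_nonneg]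
  exact mul_le_mul_of_nonneg_left (hR i) ENNReal.toReal_nonneg

theorem tendsto_tsum_toReal_smul [NormedAddCommGroup V] [NormedSpace ℝ V] [CompleteSpace V]
    (μ : PMF ι) {x : ℕ → ι → V} {y : ι → V} {R : ℝ} (hR : ∀ n i, ‖x n i‖ ≤ R)
    (hlim : ∀ i ∈ μ.support, Tendsto (fun n => x n i) atTop (𝓝 (y i))) :
    Tendsto (fun n => ∑' i, (μ i).toReal • x n i) atTop (𝓝 (∑' i, (μ i).toReal • y i)) := by
  refine tendsto_tsum_of_dominated_convergence ((hasSum_toReal_pmf μ).summable.mul_right R)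
    (fun i => ?_) (.of_forall fun n i => ?_)
  · by_cases hi : i ∈ μ.support
    · exact (hlim i hi).const_smul _
    · simp only [(μ.apply_eq_zero_iff i).mpr hi, ENNReal.toReal_zero, zero_smul,
        tendsto_const_nhds]
  · rw [norm_smul, Real.norm_of_nonneg ENNReal.toReal_nonneg]
    exact mul_le_mul_of_nonneg_left (hR n i) ENNReal.toReal_nonneg

end Convexity

section Hilbert

variable {X V : Type*} [MeasurableSpace X] [NormedAddCommGroup V] [NormedSpace ℝ V]

/-- The classes in `L²(ν; V)` of the functions in `C`. -/
def lpTwoClasses (ν : Measure X) (C : Set (X → V)) : Set (Lp V 2 ν) :=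
  {g | ∃ f ∈ C, g =ᵐ[ν] f}

theorem convex_lpTwoClasses (ν : Measure X) {C : Set (X → V)} (hconv : Convex ℝ C) :
    Convex ℝ (lpTwoClasses ν C) := by
  rintro g₁ ⟨f₁, hf₁, heq₁⟩ g₂ ⟨f₂, hf₂, heq₂⟩ a b ha hb hab
  refine ⟨a • f₁ + b • f₂, hconv hf₁ hf₂ ha hb hab, (Lp.coeFn_add _ _).trans ?_⟩
  exact ((Lp.coeFn_smul a g₁).trans (heq₁.const_smul a)).add
    ((Lp.coeFn_smul b g₂).trans (heq₂.const_smul b))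

variable {H : Type*} [NormedAddCommGroup H] [InnerProductSpace ℝ H] [CompleteSpace H]

theorem exists_mem_forall_norm_sub_sq_le {C : Set H} (hne : C.Nonempty) (hconv : Convex ℝ C)
    (hclosed : IsClosed C) : ∃ v ∈ C, ∀ w ∈ C, ‖w - v‖ ^ 2 ≤ ‖w‖ ^ 2 - ‖v‖ ^ 2 := by
  obtain ⟨v, hv, hmin⟩ := exists_norm_eq_iInf_of_complete_convex hne hclosed.isComplete hconv 0
  refine ⟨v, hv, fun w hw => ?_⟩
  have hinner := (norm_eq_iInf_iff_real_inner_le_zero hconv hv).mp hmin w hw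
  have hsq := norm_add_sq_real v (w - v)
  rw [add_sub_cancel] at hsq
  rw [zero_sub, inner_neg_left] at hinner
  linarith

theorem nonempty_iInter_of_antitone_of_convex {C : ℕ → Set H} (hne : ∀ n, (C n).Nonempty)
    (hanti : Antitone C) (hconv : ∀ n, Convex ℝ (C n)) (hclosed : ∀ n, IsClosed (C n))
    (hbdd : Bornology.IsBounded (C 0)) : (⋂ n, C n).Nonempty := by
  choose v hv hmin using fun n => exists_mem_forall_norm_sub_sq_le (hne n) (hconv n) (hclosed n)
  have hdist {m n : ℕ} (hmn : m ≤ n) : ‖v n - v m‖ ^ 2 ≤ ‖v n‖ ^ 2 - ‖v m‖ ^ 2 :=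
    hmin m _ (hanti hmn (hv n))
  have hmono : Monotone fun n => ‖v n‖ ^ 2 := fun m n hmn =>
    sub_nonneg.mp ((sq_nonneg _).trans (hdist hmn))
  obtain ⟨R, hR⟩ := hbdd.exists_norm_le
  have hbound : BddAbove (Set.range fun n => ‖v n‖ ^ 2) := by
    refine ⟨R ^ 2, Set.forall_mem_range.mpr fun n => ?_⟩
    exact pow_le_pow_left₀ (norm_nonneg _) (hR _ (hanti n.zero_le (hv n))) 2
  have hcauchy : CauchySeq v := by
    refine Metric.cauchySeq_iff'.mpr fun ε hε => ?_
    obtain ⟨N, hN⟩ := Metric.cauchySeq_iff'.mp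
      (tendsto_atTop_ciSup hmono hbound).cauchySeq (ε ^ 2) (pow_pos hε 2)
    refine ⟨N, fun n hn => lt_of_pow_lt_pow_left₀ 2 hε.le ?_⟩
    rw [dist_eq_norm]
    exact ((hdist hn).trans (le_abs_self _)).trans_lt (hN n hn)
  obtain ⟨x, hx⟩ := cauchySeq_tendsto_of_complete hcauchy
  refine ⟨x, Set.mem_iInter.mpr fun n => (hclosed n).mem_of_tendsto hx ?_⟩
  filter_upwards [eventually_ge_atTop n] with m hm
  exact hanti hm (hv m)

theorem exists_ae_tendsto_of_antitone_of_convex (ν : Measure X) [IsFiniteMeasure ν]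
    {C : ℕ → Set (X → H)} (hne : ∀ n, (C n).Nonempty) (hanti : Antitone C)
    (hconv : ∀ n, Convex ℝ (C n)) (hmeas : ∀ f ∈ C 0, AEStronglyMeasurable f ν) {R : ℝ}
    (hR : ∀ f ∈ C 0, ∀ x, ‖f x‖ ≤ R) :
    ∃ (f : ℕ → X → H) (g : X → H), (∀ n, f n ∈ C n) ∧
      ∀ᵐ x ∂ν, Tendsto (fun n => f n x) atTop (𝓝 (g x)) := by
  have hne' (n : ℕ) : (lpTwoClasses ν (C n)).Nonempty := by
    obtain ⟨f, hf⟩ := hne n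
    have hf0 := hanti n.zero_le hf
    have hmem : MemLp f 2 ν := .of_bound (hmeas f hf0) R (.of_forall (hR f hf0))
    exact ⟨hmem.toLp, f, hf, hmem.coeFn_toLp⟩
  have hanti' : Antitone fun n => lpTwoClasses ν (C n) :=
    fun m n hmn h ⟨f, hf, heq⟩ => ⟨f, hanti hmn hf, heq⟩
  have hbdd : Bornology.IsBounded (lpTwoClasses ν (C 0)) := by
    refine isBounded_iff_forall_norm_le.mpr ⟨_, fun h ⟨f, hf, heq⟩ =>
      Lp.norm_le_of_ae_bound (abs_nonneg R) ?_⟩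
    filter_upwards [heq] with x hx
    exact hx ▸ (hR f hf x).trans (le_abs_self R)
  obtain ⟨g, hg⟩ := nonempty_iInter_of_antitone_of_convex (fun n => (hne' n).closure)
    (fun m n hmn => closure_mono (hanti' hmn)) (fun n => (convex_lpTwoClasses ν (hconv n)).closure)
    (fun n => isClosed_closure) hbdd.closure
  have happrox (n : ℕ) : ∃ h ∈ lpTwoClasses ν (C n), dist g h < 1 / ((n : ℝ) + 1) :=
    Metric.mem_closure_iff.mp (Set.mem_iInter.mp hg n) _ Nat.one_div_pos_of_nat
  choose h hh hdist using happrox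
  choose f hfC heq using hh
  have hlim : Tendsto h atTop (𝓝 g) := tendsto_iff_dist_tendsto_zero.mpr <|
    squeeze_zero (fun _ => dist_nonneg) (fun n => (dist_comm (h n) g).trans_le (hdist n).le)
      tendsto_one_div_add_atTop_nhds_zero_nat
  obtain ⟨k, hk, hae⟩ := (tendstoInMeasure_of_tendsto_Lp hlim).exists_seq_tendsto_ae
  refine ⟨fun n => f (k n), g, fun n => hanti hk.le_apply (hfC (k n)), ?_⟩
  filter_upwards [hae, ae_all_iff.mpr heq] with x hx hfx
  simpa only [hfx] using hx

end Hilbert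

section WeakStar

variable {𝕜 E : Type*} [RCLike 𝕜] [NormedAddCommGroup E] [NormedSpace 𝕜 E]

variable (𝕜 E) in
theorem exists_seq_norm_le_one_dense_span [TopologicalSpace.SeparableSpace E] :
    ∃ u : ℕ → E, (∀ n, ‖u n‖ ≤ 1) ∧ Dense (Submodule.span 𝕜 (Set.range u) : Set E) := by
  let d := TopologicalSpace.denseSeq E
  have hpos (n : ℕ) : 0 < 1 + ‖d n‖ := by positivity
  refine ⟨fun n => ((1 + ‖d n‖ : ℝ) : 𝕜)⁻¹ • d n, fun n => ?_, ?_⟩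
  · rw [norm_smul, norm_inv, RCLike.norm_of_nonneg (hpos n).le, inv_mul_le_one₀ (hpos n)]
    exact le_add_of_nonneg_left zero_le_one
  · refine (TopologicalSpace.denseRange_denseSeq E).mono (Set.range_subset_iff.mpr fun n => ?_)
    have hmem := Submodule.smul_mem _ ((1 + ‖d n‖ : ℝ) : 𝕜)
      (Submodule.subset_span (R := 𝕜) (Set.mem_range_self
        (f := fun n => ((1 + ‖d n‖ : ℝ) : 𝕜)⁻¹ • d n) n))
    rwa [smul_inv_smul₀ (RCLike.ofReal_ne_zero.mpr (hpos n).ne')] at hmem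

theorem isClosedEmbedding_eval_of_dense_span {K : Set (WeakDual 𝕜 E)} (hK : IsCompact K)
    {u : ℕ → E} (hu : Dense (Submodule.span 𝕜 (Set.range u) : Set E)) :
    IsClosedEmbedding fun (f : K) (n : ℕ) => (f : WeakDual 𝕜 E) (u n) := by
  have : CompactSpace K := isCompact_iff_compactSpace.mp hK
  have hcont : Continuous fun (f : K) (n : ℕ) => (f : WeakDual 𝕜 E) (u n) :=
    continuous_pi fun n => (WeakDual.eval_continuous (u n)).comp continuous_subtype_val
  refine hcont.isClosedEmbedding fun f g hfg => Subtype.ext ?_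
  exact ContinuousLinearMap.ext_on hu (Set.eqOn_range.mpr hfg)

variable {Y : Type*}

variable (Y) in
/-- The Banach space `ℓ^∞(Y, F)` of bounded maps `Y → F`, with the supremum norm. -/
abbrev BoundedMap (F : Type*) [NormedAddCommGroup F] : Type _ :=
  lp (fun _ : Y => F) ∞

variable [MeasurableSpace Y]

variable (Y) in
/-- The bounded maps `Y → E*` with values in `K` all of whose evaluations at a vector of `E` are
measurable. -/
def measurableMapsInto (K : Set (WeakDual 𝕜 E)) : Set (BoundedMap Y (StrongDual 𝕜 E)) :=
  {ψ | (∀ y, StrongDual.toWeakDual (ψ y) ∈ K) ∧ ∀ x, Measurable fun y => ψ y x}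

theorem isClosed_measurableMapsInto {K : Set (WeakDual 𝕜 E)} (hclosed : IsClosed K) :
    IsClosed (measurableMapsInto Y K) := by
  refine isClosed_of_closure_subset fun ψ hψ => ?_
  obtain ⟨χ, hχ, hlim⟩ := mem_closure_iff_seq_limit.mp hψ
  have hpt (y : Y) : Tendsto (fun n => χ n y) atTop (𝓝 (ψ y)) :=
    ((lp.evalCLM ℝ (fun _ : Y => StrongDual 𝕜 E) ∞ y).continuous.tendsto ψ).comp hlim
  refine ⟨fun y => ?_, fun x => ?_⟩
  · exact hclosed.mem_of_tendsto
      ((NormedSpace.Dual.toWeakDual_continuous.tendsto _).comp (hpt y))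
      (.of_forall fun n => (hχ n).1 y)
  · refine measurable_of_tendsto_metrizable (fun n => (hχ n).2 x) (tendsto_pi_nhds.mpr fun y => ?_)
    exact ((ContinuousLinearMap.apply 𝕜 𝕜 x).continuous.tendsto _).comp (hpt y)

theorem convex_measurableMapsInto {K : Set (WeakDual 𝕜 E)} (hconv : Convex ℝ K) :
    Convex ℝ (measurableMapsInto Y K) := fun _ hψ _ hχ a b ha hb hab =>
  ⟨fun y => hconv (hψ.1 y) (hχ.1 y) ha hb hab,
    fun x => ((hψ.2 x).const_smul a).add ((hχ.2 x).const_smul b)⟩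

theorem isBounded_measurableMapsInto {K : Set (WeakDual 𝕜 E)} (hbdd : Bornology.IsBounded K) :
    Bornology.IsBounded (measurableMapsInto Y K) := by
  obtain ⟨R, hR0, hR⟩ :=
    (WeakDual.isBounded_toWeakDual_preimage_iff_isBounded.mpr hbdd).exists_pos_norm_le
  exact isBounded_iff_forall_norm_le.mpr
    ⟨R, fun ψ hψ => lp.norm_le_of_forall_le hR0.le fun y => hR _ (hψ.1 y)⟩

theorem nonempty_measurableMapsInto {K : Set (WeakDual 𝕜 E)} (hne : K.Nonempty) :
    (measurableMapsInto Y K).Nonempty := by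
  obtain ⟨f, hf⟩ := hne
  let ψ : BoundedMap Y (StrongDual 𝕜 E) := ⟨fun _ => WeakDual.toStrongDual f,
    memℓp_infty ⟨_, Set.forall_mem_range.mpr fun _ => le_rfl⟩⟩
  exact ⟨ψ, fun _ => hf, fun x => (measurable_const : Measurable fun _ : Y => f x)⟩

/-- The evaluations of `ψ` at the vectors `u n`, as a function of `(y, n)`. -/
def evalAlong (u : ℕ → E) : BoundedMap Y (StrongDual 𝕜 E) →ₗ[ℝ] (Y × ℕ → 𝕜) where
  toFun ψ p := ψ p.1 (u p.2)
  map_add' _ _ := rfl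
  map_smul' _ _ := rfl

theorem exists_ae_tendsto_eval_of_antitone_of_convex {u : ℕ → E} (hu : ∀ n, ‖u n‖ ≤ 1)
    (σ : Measure Y) [IsFiniteMeasure σ]
    {C : ℕ → Set (BoundedMap Y (StrongDual 𝕜 E))} (hne : ∀ n, (C n).Nonempty)
    (hanti : Antitone C) (hconv : ∀ n, Convex ℝ (C n)) (hbdd : Bornology.IsBounded (C 0))
    (hmeas : ∀ ψ ∈ C 0, ∀ x, Measurable fun y => ψ y x) :
    ∃ (ψ : ℕ → BoundedMap Y (StrongDual 𝕜 E)) (g : Y → ℕ → 𝕜), (∀ n, ψ n ∈ C n) ∧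
      ∀ᵐ y ∂σ, ∀ k, Tendsto (fun n => ψ n y (u k)) atTop (𝓝 (g y k)) := by
  let κ : Measure ℕ := (Measure.count : Measure ℕ).toFinite
  obtain ⟨R, hR⟩ := hbdd.exists_norm_le
  have hmeas' : ∀ f ∈ evalAlong u '' C 0, AEStronglyMeasurable f (σ.prod κ) := by
    rintro _ ⟨ψ, hψ, rfl⟩
    exact (measurable_from_prod_countable_left fun n => hmeas ψ hψ (u n)).aestronglyMeasurable
  have hR' : ∀ f ∈ evalAlong u '' C 0, ∀ p, ‖f p‖ ≤ R := by
    rintro _ ⟨ψ, hψ, rfl⟩ p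
    calc ‖ψ p.1 (u p.2)‖ ≤ ‖ψ p.1‖ := (ψ p.1).unit_le_opNorm _ (hu p.2)
      _ ≤ ‖ψ‖ := lp.norm_apply_le_norm ENNReal.top_ne_zero ψ p.1
      _ ≤ R := hR ψ hψ
  obtain ⟨f, g, hf, hlim⟩ := exists_ae_tendsto_of_antitone_of_convex (σ.prod κ)
    (fun n => (hne n).image (evalAlong u)) (fun m n hmn => Set.image_mono (hanti hmn))
    (fun n => (hconv n).linear_image _) hmeas' hR'
  choose ψ hψ hψf using hf
  refine ⟨ψ, fun y k => g (y, k), hψ, ?_⟩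
  filter_upwards [Measure.ae_ae_of_ae_prod hlim] with y hy
  rw [ae_toFinite, Measure.ae_count_iff] at hy
  simp only [← hψf] at hy
  exact hy

theorem exists_measurable_ae_tendsto_of_antitone_of_convex [TopologicalSpace.SeparableSpace E]
    {K : Set (WeakDual 𝕜 E)} [MeasurableSpace K] [BorelSpace K] (hclosed : IsClosed K)
    (hbdd : Bornology.IsBounded K) (σ : Measure Y) [IsFiniteMeasure σ]
    {C : ℕ → Set (BoundedMap Y (StrongDual 𝕜 E))} (hne : ∀ n, (C n).Nonempty)
    (hanti : Antitone C) (hconv : ∀ n, Convex ℝ (C n)) (hC : C 0 ⊆ measurableMapsInto Y K) :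
    ∃ (ψ : ℕ → BoundedMap Y (StrongDual 𝕜 E)) (φ : Y → K), (∀ n, ψ n ∈ C n) ∧ Measurable φ ∧
      ∀ᵐ y ∂σ, ∀ x, Tendsto (fun n => ψ n y x) atTop (𝓝 ((φ y : WeakDual 𝕜 E) x)) := by
  obtain ⟨u, hu, hspan⟩ := exists_seq_norm_le_one_dense_span 𝕜 E
  have hemb := isClosedEmbedding_eval_of_dense_span
    (WeakDual.isCompact_of_bounded_of_closed hbdd hclosed) hspan
  have : TopologicalSpace.MetrizableSpace K := hemb.isEmbedding.metrizableSpace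
  obtain ⟨ψ, g, hψ, hlim⟩ := exists_ae_tendsto_eval_of_antitone_of_convex hu σ hne hanti hconv
    ((isBounded_measurableMapsInto hbdd).subset hC) fun ψ hψ => (hC hψ).2
  have hψK (n : ℕ) : ψ n ∈ measurableMapsInto Y K := hC (hanti n.zero_le (hψ n))
  let Ψ (n : ℕ) (y : Y) : K := ⟨StrongDual.toWeakDual (ψ n y), (hψK n).1 y⟩
  have hΨ (n : ℕ) : Measurable (Ψ n) :=
    hemb.measurableEmbedding.measurable_comp_iff.mp (measurable_pi_iff.mpr fun k => (hψK n).2 (u k))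
  have hconv : ∀ᵐ y ∂σ, ∃ f : K, Tendsto (fun n => Ψ n y) atTop (𝓝 f) := by
    filter_upwards [hlim] with y hy
    have hpi : Tendsto (fun n k => ψ n y (u k)) atTop (𝓝 (g y)) := tendsto_pi_nhds.mpr hy
    obtain ⟨f, hf⟩ := hemb.isClosed_range.mem_of_tendsto hpi
      (.of_forall fun n => Set.mem_range_self (Ψ n y))
    rw [← hf] at hpi
    exact ⟨f, hemb.isInducing.tendsto_nhds_iff.mpr hpi⟩
  obtain ⟨φ, hφ, hφlim⟩ := measurable_limit_of_tendsto_metrizable_ae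
    (fun n => (hΨ n).aemeasurable) hconv
  refine ⟨ψ, φ, hψ, hφ, hφlim.mono fun y hy x => ?_⟩
  exact (((WeakDual.eval_continuous x).comp continuous_subtype_val).tendsto (φ y)).comp hy

end WeakStar

section Averaging

variable {ι Y : Type*} {F : Type*} [NormedAddCommGroup F] [NormedSpace ℝ F]

/-- The operator `ψ ↦ S ∘ ψ ∘ t` on bounded maps. -/
noncomputable def transferOperator (t : Y → Y) (S : F →L[ℝ] F) :
    BoundedMap Y F →L[ℝ] BoundedMap Y F :=
  LinearMap.mkContinuous
    { toFun ψ := ⟨fun y => S (ψ (t y)), memℓp_infty ⟨‖S‖ * ‖ψ‖, Set.forall_mem_range.mpr fun y =>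
        S.le_opNorm_of_le (lp.norm_apply_le_norm ENNReal.top_ne_zero ψ (t y))⟩⟩
      map_add' ψ χ := Subtype.ext (funext fun y => map_add S (ψ (t y)) (χ (t y)))
      map_smul' c ψ := Subtype.ext (funext fun y => map_smul S c (ψ (t y))) }
    ‖S‖ fun ψ => lp.norm_le_of_forall_le (by positivity) fun y =>
      S.le_opNorm_of_le (lp.norm_apply_le_norm ENNReal.top_ne_zero ψ (t y))

theorem norm_transferOperator_le (t : Y → Y) (S : F →L[ℝ] F) : ‖transferOperator t S‖ ≤ ‖S‖ :=
  LinearMap.mkContinuous_norm_le _ (norm_nonneg S) _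

/-- The averaging operator `ψ ↦ ∑ i, μ i • (S i ∘ ψ ∘ t i)` on bounded maps; the sum converges in
operator norm as soon as the `S i` are uniformly bounded. -/
noncomputable def averagingOperator (μ : PMF ι) (t : ι → Y → Y) (S : ι → F →L[ℝ] F) :
    BoundedMap Y F →L[ℝ] BoundedMap Y F :=
  ∑' i, (μ i).toReal • transferOperator (t i) (S i)

theorem hasSum_averagingOperator [CompleteSpace F] (μ : PMF ι) (t : ι → Y → Y)
    {S : ι → F →L[ℝ] F} {c : ℝ} (hS : ∀ i, ‖S i‖ ≤ c) :
    HasSum (fun i => (μ i).toReal • transferOperator (t i) (S i)) (averagingOperator μ t S) :=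
  (summable_toReal_smul μ fun i => (norm_transferOperator_le (t i) (S i)).trans (hS i)).hasSum

theorem hasSum_averagingOperator_apply [CompleteSpace F] (μ : PMF ι) (t : ι → Y → Y)
    {S : ι → F →L[ℝ] F} {c : ℝ} (hS : ∀ i, ‖S i‖ ≤ c) (ψ : BoundedMap Y F) :
    HasSum (fun i => (μ i).toReal • transferOperator (t i) (S i) ψ) (averagingOperator μ t S ψ) :=
  (hasSum_averagingOperator μ t hS).mapL (ContinuousLinearMap.apply ℝ _ ψ)

variable {𝕜 E : Type*} [RCLike 𝕜] [NormedAddCommGroup E] [NormedSpace 𝕜 E]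

/-- The adjoint `f ↦ f ∘ θ` of `θ`, as a real-linear operator on the dual. -/
noncomputable def realAdjoint (θ : E →L[𝕜] E) : StrongDual 𝕜 E →L[ℝ] StrongDual 𝕜 E :=
  ((ContinuousLinearMap.compL 𝕜 E E 𝕜).flip θ).restrictScalars ℝ

theorem norm_realAdjoint_le (θ : E →L[𝕜] E) : ‖realAdjoint θ‖ ≤ ‖θ‖ := by
  refine ContinuousLinearMap.opNorm_le_bound _ (norm_nonneg θ) fun f => ?_
  exact (f.opNorm_comp_le θ).trans_eq (mul_comm _ _)

theorem hasSum_averagingOperator_realAdjoint (μ : PMF ι) (t : ι → Y → Y) {θ : ι → E →L[𝕜] E}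
    {c : ℝ} (hθ : ∀ i, ‖θ i‖ ≤ c) (ψ : BoundedMap Y (StrongDual 𝕜 E)) :
    HasSum (fun i => (μ i).toReal • transferOperator (t i) (realAdjoint (θ i)) ψ)
      (averagingOperator μ t (fun i => realAdjoint (θ i)) ψ) := by
  have hS (i : ι) : ‖realAdjoint (θ i)‖ ≤ c := (norm_realAdjoint_le _).trans (hθ i)
  exact hasSum_averagingOperator_apply (F := StrongDual 𝕜 E) μ t hS ψ

theorem hasSum_averagingOperator_realAdjoint_apply (μ : PMF ι) (t : ι → Y → Y)
    {θ : ι → E →L[𝕜] E} {c : ℝ} (hθ : ∀ i, ‖θ i‖ ≤ c) (ψ : BoundedMap Y (StrongDual 𝕜 E)) (y : Y)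
    (x : E) :
    HasSum (fun i => (μ i).toReal • ψ (t i y) (θ i x))
      (averagingOperator μ t (fun i => realAdjoint (θ i)) ψ y x) :=
  (hasSum_averagingOperator_realAdjoint μ t hθ ψ).mapL
    (((ContinuousLinearMap.apply 𝕜 𝕜 x).restrictScalars ℝ).comp
      (lp.evalCLM ℝ (fun _ : Y => StrongDual 𝕜 E) ∞ y))

theorem mapsTo_averagingOperator_realAdjoint [MeasurableSpace Y] {K : Set (WeakDual 𝕜 E)}
    (hclosed : IsClosed K) (hconv : Convex ℝ K) (μ : PMF ι) {t : ι → Y → Y}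
    (ht : ∀ i, Measurable (t i)) {θ : ι → E →L[𝕜] E} {c : ℝ} (hθ : ∀ i, ‖θ i‖ ≤ c)
    (hK : ∀ i, ∀ f ∈ K, StrongDual.toWeakDual (WeakDual.toStrongDual f ∘L θ i) ∈ K) :
    Set.MapsTo (averagingOperator μ t fun i => realAdjoint (θ i)) (measurableMapsInto Y K)
      (measurableMapsInto Y K) := by
  intro ψ hψ
  refine hasSum_smul_mem_of_isClosed_of_convex (isClosed_measurableMapsInto hclosed)
    (convex_measurableMapsInto hconv) (fun _ => ENNReal.toReal_nonneg) (hasSum_toReal_pmf μ)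
    (fun i => ?_) (hasSum_averagingOperator_realAdjoint μ t hθ ψ)
  exact ⟨fun y => hK i _ (hψ.1 (t i y)), fun x => (hψ.2 (θ i x)).comp (ht i)⟩

end Averaging

section Stationary

variable {V : Type*} [NormedAddCommGroup V] [NormedSpace ℝ V]

/-- The points of `K` that `T` moves by at most `ε`. -/
def almostFixedPoints (T : V →L[ℝ] V) (K : Set V) (ε : ℝ) : Set V :=
  {x ∈ K | ‖T x - x‖ ≤ ε}

theorem convex_almostFixedPoints (T : V →L[ℝ] V) {K : Set V} (hconv : Convex ℝ K) (ε : ℝ) :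
    Convex ℝ (almostFixedPoints T K ε) := by
  have hball := (convex_closedBall (0 : V) ε).linear_preimage (T.toLinearMap - LinearMap.id)
  convert hconv.inter hball using 1
  ext x
  simp only [almostFixedPoints, Set.mem_ofPred_eq, Set.mem_inter_iff, Set.mem_preimage,
    LinearMap.sub_apply, LinearMap.id_apply, ContinuousLinearMap.coe_coe, mem_closedBall_zero_iff]

variable {ι 𝕜 E Y : Type*} [RCLike 𝕜] [NormedAddCommGroup E] [NormedSpace 𝕜 E]

theorem tendsto_apply_of_almostFixedPoints
    {T : BoundedMap Y (StrongDual 𝕜 E) →L[ℝ] BoundedMap Y (StrongDual 𝕜 E)}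
    {M : Set (BoundedMap Y (StrongDual 𝕜 E))} {ψ : ℕ → BoundedMap Y (StrongDual 𝕜 E)}
    (hψ : ∀ n : ℕ, ψ n ∈ almostFixedPoints T M (1 / ((n : ℝ) + 1))) {y : Y} {x : E} {z : 𝕜}
    (hz : Tendsto (fun n => ψ n y x) atTop (𝓝 z)) :
    Tendsto (fun n => T (ψ n) y x) atTop (𝓝 z) := by
  have hdist (n : ℕ) : ‖T (ψ n) y x - ψ n y x‖ ≤ 1 / ((n : ℝ) + 1) * ‖x‖ :=
    ContinuousLinearMap.le_of_opNorm_le (T (ψ n) y - ψ n y)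
      ((lp.norm_apply_le_norm ENNReal.top_ne_zero _ y).trans (hψ n).2) x
  have hzero : Tendsto (fun n : ℕ => 1 / ((n : ℝ) + 1) * ‖x‖) atTop (𝓝 0) := by
    simpa only [zero_mul] using tendsto_one_div_add_atTop_nhds_zero_nat.mul_const ‖x‖
  simpa only [sub_add_cancel, zero_add] using (squeeze_zero_norm hdist hzero).add hz

variable [MeasurableSpace Y]

theorem exists_isFiniteMeasure_forall_ae_comp {Z : Type*} [Countable ι] [MeasurableSpace Z]
    (η : Measure Y) [SFinite η] {t : ι → Y → Z} (ht : ∀ i, Measurable (t i)) :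
    ∃ σ : Measure Z, IsFiniteMeasure σ ∧
      ∀ p : Z → Prop, (∀ᵐ z ∂σ, p z) → ∀ᵐ y ∂η, ∀ i, p (t i y) := by
  refine ⟨(Measure.sum fun i => η.map (t i)).toFinite, inferInstance, fun p hp => ?_⟩
  rw [ae_toFinite, Measure.ae_sum_iff] at hp
  exact ae_all_iff.mpr fun i => ae_of_ae_map (ht i).aemeasurable (hp i)

theorem hasSum_of_tendsto_of_almostFixedPoints {K : Set (WeakDual 𝕜 E)}
    (hbdd : Bornology.IsBounded K) {μ : PMF ι} {t : ι → Y → Y} {θ : ι → E →L[𝕜] E} {c : ℝ}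
    (hθ : ∀ i, ‖θ i‖ ≤ c) {ψ : ℕ → BoundedMap Y (StrongDual 𝕜 E)}
    (hψ : ∀ n : ℕ, ψ n ∈ almostFixedPoints (averagingOperator μ t fun i => realAdjoint (θ i))
      (measurableMapsInto Y K) (1 / ((n : ℝ) + 1)))
    {φ : Y → K} {y : Y}
    (hy : ∀ x, Tendsto (fun n => ψ n y x) atTop (𝓝 ((φ y : WeakDual 𝕜 E) x)))
    (hty : ∀ i ∈ μ.support, ∀ x,
      Tendsto (fun n => ψ n (t i y) x) atTop (𝓝 ((φ (t i y) : WeakDual 𝕜 E) x))) (x : E) :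
    HasSum (fun i => (μ i).toReal • (φ (t i y) : WeakDual 𝕜 E) (θ i x))
      ((φ y : WeakDual 𝕜 E) x) := by
  obtain ⟨R, hR⟩ :=
    (WeakDual.isBounded_toWeakDual_preimage_iff_isBounded.mpr hbdd).exists_norm_le
  have hbound (f : StrongDual 𝕜 E) (hf : StrongDual.toWeakDual f ∈ K) (i : ι) :
      ‖f (θ i x)‖ ≤ R * (c * ‖x‖) :=
    f.le_of_opNorm_le_of_le (hR f hf) ((θ i).le_of_opNorm_le (hθ i) x)
  have hsum : Summable fun i => (μ i).toReal • (φ (t i y) : WeakDual 𝕜 E) (θ i x) :=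
    summable_toReal_smul μ fun i => hbound _ (φ (t i y)).2 i
  have hlim := tendsto_tsum_toReal_smul μ (fun n i => hbound _ ((hψ n).1.1 (t i y)) i)
    fun i hi => hty i hi (θ i x)
  simp only [(hasSum_averagingOperator_realAdjoint_apply μ t hθ _ y x).tsum_eq] at hlim
  exact hsum.hasSum_iff.mpr
    (tendsto_nhds_unique hlim (tendsto_apply_of_almostFixedPoints hψ (hy x)))

theorem exists_measurable_ae_hasSum_smul_comp [TopologicalSpace.SeparableSpace E]
    {K : Set (WeakDual 𝕜 E)} [MeasurableSpace K] [BorelSpace K] (hne : K.Nonempty)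
    (hconv : Convex ℝ K) (hclosed : IsClosed K) (hbdd : Bornology.IsBounded K)
    (μ : PMF ι) {θ : ι → E →L[𝕜] E} {c : ℝ} (hθ : ∀ i, ‖θ i‖ ≤ c)
    (hK : ∀ i, ∀ f ∈ K, StrongDual.toWeakDual (WeakDual.toStrongDual f ∘L θ i) ∈ K)
    {t : ι → Y → Y} (ht : ∀ i, Measurable (t i)) (η : Measure Y) [SFinite η] :
    ∃ φ : Y → K, Measurable φ ∧ ∀ᵐ y ∂η, ∀ x,
      HasSum (fun i => (μ i).toReal • (φ (t i y) : WeakDual 𝕜 E) (θ i x))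
        ((φ y : WeakDual 𝕜 E) x) := by
  have : Countable μ.support := μ.support_countable.to_subtype
  obtain ⟨σ, _, hσ⟩ := exists_isFiniteMeasure_forall_ae_comp η
    (t := fun i : Option μ.support => i.elim id fun i => t i)
    (Option.forall.mpr ⟨measurable_id, fun i => ht i⟩)
  let T := averagingOperator μ t fun i => realAdjoint (θ i)
  let M := measurableMapsInto Y K
  have hnonempty (n : ℕ) : (almostFixedPoints T M (1 / ((n : ℝ) + 1))).Nonempty := by
    obtain ⟨ψ, hψ, hTψ⟩ := exists_mem_norm_map_sub_lt (nonempty_measurableMapsInto hne)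
      (convex_measurableMapsInto hconv) (isBounded_measurableMapsInto hbdd) T.toLinearMap
      (mapsTo_averagingOperator_realAdjoint hclosed hconv μ ht hθ hK)
      (Nat.one_div_pos_of_nat (n := n))
    exact ⟨ψ, hψ, hTψ.le⟩
  have hanti : Antitone fun n : ℕ => almostFixedPoints T M (1 / ((n : ℝ) + 1)) :=
    fun m n hmn ψ hψ => ⟨hψ.1, hψ.2.trans (Nat.one_div_le_one_div hmn)⟩
  obtain ⟨ψ, φ, hψ, hφ, hlim⟩ := exists_measurable_ae_tendsto_of_antitone_of_convex hclosed hbdd σ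
    hnonempty hanti (fun n => convex_almostFixedPoints T (convex_measurableMapsInto hconv) _)
    (Set.sep_subset _ _)
  refine ⟨φ, hφ, (hσ _ hlim).mono fun y hy => ?_⟩
  exact hasSum_of_tendsto_of_almostFixedPoints hbdd hθ hψ (hy none) fun i hi => hy (some ⟨i, hi⟩)

end Stationary

section StateSpace

variable {A : Type*} [CStarAlgebra A]

theorem norm_norm_smul_one_sub_star_mul_self_le (a : A) :
    ‖‖star a * a‖ • (1 : A) - star a * a‖ ≤ ‖star a * a‖ := by
  nontriviality A
  let _ := CStarAlgebra.spectralOrder A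
  let _ := CStarAlgebra.spectralOrderedRing A
  have hle := (IsSelfAdjoint.star_mul_self a).le_algebraMap_norm_self
  rw [Algebra.algebraMap_eq_smul_one] at hle
  calc ‖‖star a * a‖ • (1 : A) - star a * a‖ ≤ ‖‖star a * a‖ • (1 : A)‖ :=
        CStarAlgebra.norm_le_norm_of_nonneg_of_le (sub_nonneg.mpr hle)
          (sub_le_self _ (star_mul_self_nonneg a))
    _ = ‖star a * a‖ := by rw [norm_smul, norm_norm, norm_one, mul_one]

theorem norm_add_I_smul_one_sq_le {b : A} (hb : IsSelfAdjoint b) (t : ℝ) :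
    ‖b + (t * Complex.I) • (1 : A)‖ ^ 2 ≤ ‖b‖ ^ 2 + t ^ 2 := by
  rcases subsingleton_or_nontrivial A with _ | _
  · rw [Subsingleton.elim (b + _) 0, norm_zero, zero_pow two_ne_zero]
    positivity
  have hstar : star (b + (t * Complex.I) • (1 : A)) = b - (t * Complex.I) • (1 : A) := by
    simp [hb.star_eq, sub_eq_add_neg]
  have hprod : star (b + (t * Complex.I) • (1 : A)) * (b + (t * Complex.I) • (1 : A)) =
      b * b + ((t ^ 2 : ℝ) : ℂ) • (1 : A) := by
    have hI : (t * Complex.I) * (t * Complex.I) = -((t ^ 2 : ℝ) : ℂ) := by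
      rw [mul_mul_mul_comm, Complex.I_mul_I, Complex.ofReal_pow]
      ring
    rw [hstar, ← neg_neg ((t ^ 2 : ℝ) : ℂ), ← hI]
    simp only [sub_mul, mul_add, smul_mul_assoc, mul_smul_comm, one_mul, mul_one]
    module
  rw [sq, ← CStarRing.norm_star_mul_self, hprod]
  refine (norm_add_le _ _).trans (add_le_add ((norm_mul_le b b).trans_eq (sq _).symm) ?_)
  rw [norm_smul, norm_one, mul_one, Complex.norm_of_nonneg (sq_nonneg t)]

theorem re_apply_star_mul_self_nonneg {f : StrongDual ℂ A} (hf : ‖f‖ ≤ 1) (hf1 : f 1 = 1) (a : A) :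
    0 ≤ (f (star a * a)).re := by
  have h := (Complex.re_le_norm _).trans
    ((f.le_of_opNorm_le_of_le hf (norm_norm_smul_one_sub_star_mul_self_le a)).trans_eq (one_mul _))
  rw [map_sub, f.map_smul_of_tower, hf1, Complex.real_smul, mul_one, Complex.sub_re,
    Complex.ofReal_re] at h
  linarith

theorem im_apply_eq_zero_of_isSelfAdjoint {f : StrongDual ℂ A} (hf : ‖f‖ ≤ 1) (hf1 : f 1 = 1)
    {b : A} (hb : IsSelfAdjoint b) : (f b).im = 0 := by
  have hline (t : ℝ) : 2 * t * (f b).im ≤ ‖b‖ ^ 2 := by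
    have him : |(f b).im + t| ≤ ‖b + (t * Complex.I) • (1 : A)‖ := by
      have h := (Complex.abs_im_le_norm _).trans (f.le_of_opNorm_le hf (b + (t * Complex.I) • 1))
      simpa [hf1] using h
    have hsq := (sq_le_sq.mpr (him.trans (le_abs_self _))).trans (norm_add_I_smul_one_sq_le hb t)
    linarith [sq_nonneg (f b).im, add_sq (f b).im t]
  by_contra him
  have h := hline ((‖b‖ ^ 2 + 1) / (2 * (f b).im))
  rw [mul_right_comm, mul_div_cancel₀ _ (mul_ne_zero two_ne_zero him)] at h
  linarith

theorem norm_apply_le_of_mem_stateSpace {f : WeakDual ℂ A} (hf : f ∈ stateSpace A) (a : A) :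
    ‖f a‖ ≤ ‖a‖ := by
  let _ := CStarAlgebra.spectralOrder A
  let _ := CStarAlgebra.spectralOrderedRing A
  let g : A →ₚ[ℂ] ℂ := .mk₀ (WeakDual.toStrongDual f).toLinearMap fun x hx => by
    obtain ⟨b, rfl⟩ := CStarAlgebra.nonneg_iff_eq_star_mul_self.mp hx
    exact hf.1 b
  have : Nontrivial A := ⟨1, 0, fun h => by simpa [h] using hf.2⟩
  have hg (b : A) : g b = f b := rfl
  have hnorm (b : A) : ‖g.toPreGNS b‖ ≤ ‖b‖ := by
    have h := g.norm_apply_le_of_nonneg (star b * b) (star_mul_self_nonneg b)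
    have hsq : ‖g.toPreGNS b‖ ^ 2 = ‖g (star b * b)‖ := by
      simpa using congrArg norm (g.preGNS_norm_sq (g.toPreGNS b))
    rw [hg 1, hf.2, norm_one, one_mul, CStarRing.norm_star_mul_self, ← sq, ← hsq] at h
    exact le_of_sq_le_sq h (norm_nonneg b)
  have hinner : inner ℂ (g.toPreGNS 1) (g.toPreGNS a) = f a := by
    rw [g.preGNS_inner_def, hg]
    simp
  calc ‖f a‖ = ‖inner ℂ (g.toPreGNS 1) (g.toPreGNS a)‖ := by rw [hinner]
    _ ≤ ‖g.toPreGNS 1‖ * ‖g.toPreGNS a‖ := norm_inner_le_norm _ _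
    _ ≤ ‖(1 : A)‖ * ‖a‖ := mul_le_mul (hnorm 1) (hnorm a) (norm_nonneg _) (norm_nonneg _)
    _ = ‖a‖ := by rw [norm_one, one_mul]

theorem mem_stateSpace_iff_norm_le_one {f : WeakDual ℂ A} :
    f ∈ stateSpace A ↔ ‖WeakDual.toStrongDual f‖ ≤ 1 ∧ f 1 = 1 := by
  refine ⟨fun hf => ⟨?_, hf.2⟩, fun ⟨hf, hf1⟩ => ⟨fun a => ?_, hf1⟩⟩
  · exact ContinuousLinearMap.opNorm_le_bound _ zero_le_one fun a =>
      (norm_apply_le_of_mem_stateSpace hf a).trans_eq (one_mul _).symm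
  · exact Complex.nonneg_iff.mpr ⟨re_apply_star_mul_self_nonneg hf hf1 a,
      (im_apply_eq_zero_of_isSelfAdjoint hf hf1 (.star_mul_self a)).symm⟩

theorem stateSpace_eq_preimage_closedBall_inter :
    stateSpace A = WeakDual.toStrongDual ⁻¹' Metric.closedBall 0 1 ∩ {f | f 1 = 1} := by
  ext f
  rw [mem_stateSpace_iff_norm_le_one, Set.mem_inter_iff, Set.mem_preimage,
    mem_closedBall_zero_iff, Set.mem_ofPred_eq]

variable (A)

theorem isClosed_stateSpace : IsClosed (stateSpace A) := by
  rw [stateSpace_eq_preimage_closedBall_inter]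
  exact (WeakDual.isClosed_closedBall 0 1).inter
    (isClosed_eq (WeakDual.eval_continuous 1) continuous_const)

theorem isBounded_stateSpace : Bornology.IsBounded (stateSpace A) := by
  refine WeakDual.isBounded_toWeakDual_preimage_iff_isBounded.mp
    (isBounded_iff_forall_norm_le.mpr ⟨1, fun f hf => ?_⟩)
  exact (mem_stateSpace_iff_norm_le_one.mp hf).1

theorem convex_stateSpace : Convex ℝ (stateSpace A) := by
  rintro f ⟨hf, hf1⟩ g ⟨hg, hg1⟩ a b ha hb hab
  refine ⟨fun x => ?_, ?_⟩
  · change 0 ≤ a • f (star x * x) + b • g (star x * x)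
    exact add_nonneg (smul_nonneg ha (hf x)) (smul_nonneg hb (hg x))
  · change a • f 1 + b • g 1 = 1
    rw [hf1, hg1, ← add_smul, hab, one_smul]

theorem stateSpace_nonempty [Nontrivial A] : (stateSpace A).Nonempty := by
  obtain ⟨f, hf, hf1⟩ := exists_dual_vector'' ℂ (1 : A)
  exact ⟨StrongDual.toWeakDual f,
    mem_stateSpace_iff_norm_le_one.mpr ⟨hf, by simpa using hf1⟩⟩

variable {A}

theorem comp_mem_stateSpace {f : WeakDual ℂ A} (hf : f ∈ stateSpace A) {θ : A →L[ℂ] A}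
    (hθ : ‖θ‖ ≤ 1) (hθ1 : θ 1 = 1) :
    StrongDual.toWeakDual (WeakDual.toStrongDual f ∘L θ) ∈ stateSpace A := by
  obtain ⟨hnorm, hf1⟩ := mem_stateSpace_iff_norm_le_one.mp hf
  refine mem_stateSpace_iff_norm_le_one.mpr ⟨?_, ?_⟩
  · exact (ContinuousLinearMap.opNorm_comp_le _ θ).trans (mul_le_one₀ hnorm (norm_nonneg θ) hθ)
  · exact (congrArg f hθ1).trans hf1

end StateSpace

theorem mainTheorem10_general {ι A Y : Type*}
    [CStarAlgebra A] [Nontrivial A] [TopologicalSpace.SeparableSpace A]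
    {θ : ι → A →L[ℂ] A} (hθ : ∀ i, ‖θ i‖ ≤ 1) (hθ1 : ∀ i, θ i 1 = 1)
    [MeasurableSpace Y] {t : ι → Y → Y} (ht : ∀ i, Measurable (t i))
    (η : Measure Y) [SFinite η] (μ : PMF ι) :
    ∃ φ : Y → stateSpace A, Measurable φ ∧ ∀ᵐ y ∂η, ∀ a : A,
      HasSum (fun i => ((μ i).toReal : ℂ) * (φ (t i y) : WeakDual ℂ A) (θ i a))
        ((φ y : WeakDual ℂ A) a) := by
  simpa only [Complex.real_smul] using exists_measurable_ae_hasSum_smul_comp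
    (stateSpace_nonempty A) (convex_stateSpace A) (isClosed_stateSpace A) (isBounded_stateSpace A)
    μ hθ (fun i f hf => comp_mem_stateSpace hf (hθ i) (hθ1 i)) ht η

theorem mainTheorem10 {Γ A Y : Type*} [Group Γ]
    [CStarAlgebra A] [Nontrivial A] [TopologicalSpace.SeparableSpace A]
    (α : Γ →* (A ≃⋆ₐ[ℂ] A))
    [MeasurableSpace Y] [MulAction Γ Y] [MeasurableConstSMul Γ Y]
    (η : MeasureTheory.Measure Y) [MeasureTheory.IsProbabilityMeasure η]
    (μ : PMF Γ) :
    ∃ φ : Y → stateSpace A, Measurable φ ∧ IsStationaryStateMap α μ η φ := by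
  let θ (s : Γ) : A →L[ℂ] A := LinearMap.mkContinuous (α s⁻¹ : A →⋆ₐ[ℂ] A).toLinearMap 1
    fun a => (StarAlgEquiv.norm_map (α s⁻¹) a).trans_le (one_mul ‖a‖).ge
  exact mainTheorem10_general (θ := θ) (fun _ => LinearMap.mkContinuous_norm_le _ zero_le_one _)
    (fun s => map_one (α s⁻¹)) (fun s => measurable_const_smul s⁻¹) η μ
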